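/- **Theorem (partial derivatives of $\wp$ with respect to the periods).** Let $\omega_1,\omega_2\in\mathbb C$ be linearly independent over $\mathbb R$ with $\operatorname{Im}(\omega_2/\omega_1)>0$, and let $\Lambda=\{m_1\omega_1+m_2\omega_2:\ m_1,m_2\in\mathbb Z\}$. Put $$\wp(z)=\wp(z;\omega_1,\omega_2)=\frac1{z^2}+\sum_{\omega\in\Lambda\setminus\{0\}}\left[\frac1{(z-\omega)^2}-\frac1{\omega^2}\right],\qquad \zeta(z)=\frac1z+\sum_{\omega\in\Lambda\setminus\{0\}}\left[\frac1{z-\omega}+\frac1\omega+\frac z{\omega^2}\right],$$ $$\eta_k=2\zeta(\omega_k/2)\quad(k=1,2),\qquad g_2=60\sum_{\omega\in\Lambda\setminus\{0\}}\frac1{\omega^4},$$ and let $\wp'$ denote the derivative of $\wp$ in $z$. Then for every $z\in\mathbb C\setminus\Lambda$ the complex partial derivatives of $\wp(z;\omega_1,\omega_2)$ with respect to $\omega_1$ (with $z,\omega_2$ fixed) and with respect to $\omega_2$ (with $z,\omega_1$ fixed) exist and are equal to $$\frac{\partial\wp(z)}{\partial\omega_1}=-\frac1{2\pi i}\left[2\omega_2\,\wp(z)^2-2\eta_2\,\wp(z)+(\omega_2\zeta(z)-\eta_2z)\,\wp'(z)-\omega_2\frac{g_2}3\right],$$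 $$\frac{\partial\wp(z)}{\partial\omega_2}=\frac1{2\pi i}\left[2\omega_1\,\wp(z)^2-2\eta_1\,\wp(z)+(\omega_1\zeta(z)-\eta_1z)\,\wp'(z)-\omega_1\frac{g_2}3\right].$$ -/

import Mathlib

open scoped PeriodPair

noncomputable section

namespace PeriodPair

/-- The Weierstrass zeta function of a pair of periods,
`ζ(z) = 1/z + ∑' (1/(z - ω) + 1/ω + z/ω²)`, the sum being over the nonzero lattice points `ω`. -/
def weierstrassZeta (L : PeriodPair) (z : ℂ) : ℂ :=
  1 / z + ∑' l : {l : ℂ // l ∈ L.lattice ∧ l ≠ 0}, (1 / (z - l) + 1 / (l : ℂ) + z / (l : ℂ) ^ 2)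

/-- The quasi-period `η₁ = 2 ζ(ω₁ / 2)`. -/
def η₁ (L : PeriodPair) : ℂ := 2 * L.weierstrassZeta (L.ω₁ / 2)

/-- The quasi-period `η₂ = 2 ζ(ω₂ / 2)`. -/
def η₂ (L : PeriodPair) : ℂ := 2 * L.weierstrassZeta (L.ω₂ / 2)

open Classical in
/-- The Weierstrass function `℘(z; ω₁, ω₂)` as a function of three complex variables.
It is extended by `0` to the pairs `(ω₁, ω₂)` that are linearly dependent over `ℝ`; these form a
closed set, so the extension does not affect partial derivatives at an admissible pair. -/
def weierstrassPFun (z ω₁ ω₂ : ℂ) : ℂ :=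
  if h : LinearIndependent ℝ ![ω₁, ω₂] then ℘[(⟨ω₁, ω₂, h⟩ : PeriodPair)] z else 0

theorem weierstrassPFun_eq (L : PeriodPair) (z : ℂ) :
    weierstrassPFun z L.ω₁ L.ω₂ = ℘[L] z := by
  unfold weierstrassPFun
  rw [dif_pos L.indep]

end PeriodPair

end

open scoped PeriodPair Topology
open Filter Asymptotics

noncomputable section

namespace PeriodPair

/-! Moving `ω₁` to `w` moves `l = m₁ω₁ + m₂ω₂` to `l + (w - ω₁)m₁`, so differentiating the series of
`℘` termwise gives `D(z) = ∑ m₁(l)(2/(z-l)³ + 2/l³)` (`hasDerivAt_weierstrassPFun_ω₁`). Under `z ↦ z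
+ l₀`, `D` changes by `-m₁(l₀)℘'(z)` (`weierstrassPDerivω₁_add`). The bracket `E` in the formula is
invariant under `ω₂` and gains `(η₁ω₂ - η₂ω₁)℘' = 2πi℘'` under `ω₁`, by Legendre's relation. Hence
`2πi D + E` is elliptic.

At the origin the poles of `E` cancel and the `g₂` term makes its limit `0` (`tendsto_periodExpr`),
while `D(0) = 0`. So `2πi D + E` extends to a bounded entire function vanishing at `0`, and
Liouville's theorem gives `2πi D = -E`. The `ω₂` formula is the `ω₁` formula for the basis `(ω₂,
-ω₁)` of the same lattice. -/

variable (L : PeriodPair)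

/-! ### The zeta function: convergence, derivative, quasi-periods. -/

/-- The Weierstrass zeta function with the polar part `1 / z` at the origin removed. -/
def weierstrassZetaExcept (z : ℂ) : ℂ :=
  ∑' l : L.lattice, if l.1 = 0 then 0 else (1 / (z - l) + 1 / (l : ℂ) + z / (l : ℂ) ^ 2)

lemma weierstrassZeta_eq (z : ℂ) :
    L.weierstrassZeta z = 1 / z + L.weierstrassZetaExcept z := by
  unfold weierstrassZeta weierstrassZetaExcept
  congr 1
  let g : {l : ℂ // l ∈ L.lattice ∧ l ≠ 0} → L.lattice := fun l ↦ ⟨l.1, l.2.1⟩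
  have hg : Function.Injective g := fun a b h ↦ Subtype.ext (congr_arg (fun x : L.lattice ↦ x.1) h)
  rw [← hg.tsum_eq]
  · refine tsum_congr fun l ↦ ?_
    rw [if_neg l.2.2]
  · intro l hl
    refine ⟨⟨l.1, l.2, fun h ↦ ?_⟩, rfl⟩
    exact hl (if_pos h)

/-- The summand equals `s²/((s - l)l²)`, of order `|l|⁻³`, which is summable over a lattice of rank
2. -/
lemma weierstrassZeta_bound {r : ℝ} {s l : ℂ} (hr : 0 < r) (hs : ‖s‖ < r) (h : 2 * r ≤ ‖l‖) :
    ‖1 / (s - l) + 1 / l + s / l ^ 2‖ ≤ 2 * r ^ 2 * ‖l‖ ^ (-3 : ℝ) := by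
  have hl : 0 < ‖l‖ := by linarith
  have hl0 : l ≠ 0 := norm_pos_iff.mp hl
  have hsl : ‖l‖ / 2 ≤ ‖s - l‖ := by
    have := norm_sub_norm_le l s
    rw [norm_sub_rev] at this
    linarith
  have hsl0 : s - l ≠ 0 := norm_pos_iff.mp (by linarith)
  have e : 1 / (s - l) + 1 / l + s / l ^ 2 = s ^ 2 / ((s - l) * l ^ 2) := by
    field_simp
    ring
  rw [e, norm_div, norm_mul, norm_pow, norm_pow]
  calc ‖s‖ ^ 2 / (‖s - l‖ * ‖l‖ ^ 2) ≤ r ^ 2 / (‖l‖ / 2 * ‖l‖ ^ 2) := by gcongr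
    _ = 2 * r ^ 2 / ‖l‖ ^ 3 := by field
    _ = _ := by norm_cast

lemma hasSumLocallyUniformly_weierstrassZetaExcept :
    HasSumLocallyUniformly (fun (l : L.lattice) (z : ℂ) ↦
      if l.1 = 0 then 0 else (1 / (z - l) + 1 / (l : ℂ) + z / (l : ℂ) ^ 2))
      L.weierstrassZetaExcept := by
  refine L.hasSumLocallyUniformly_aux (u := (2 * · ^ 2 * ‖·‖ ^ (-3 : ℝ))) _
    (fun _ _ ↦ (ZLattice.summable_norm_rpow _ _ (by simp; norm_num)).mul_left _) fun r hr ↦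
    Filter.eventually_atTop.mpr ⟨2 * r, ?_⟩
  rintro _ h s hs l rfl
  split_ifs
  · simpa using! show 0 ≤ 2 * r ^ 2 * (‖↑l‖ ^ 3)⁻¹ by positivity
  · exact weierstrassZeta_bound hr hs h

lemma differentiableOn_weierstrassZetaExcept_summand (l : L.lattice) :
    DifferentiableOn ℂ (fun z : ℂ ↦
      if l.1 = 0 then 0 else (1 / (z - l) + 1 / (l : ℂ) + z / (l : ℂ) ^ 2))
      (L.lattice \ {0})ᶜ := by
  split_ifs with h
  · simp
  · intro x hx
    have : x - l ≠ 0 := by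
      rw [sub_ne_zero]
      rintro rfl
      exact hx ⟨l.2, h⟩
    have h2 : (l : ℂ) ^ 2 ≠ 0 := pow_ne_zero _ h
    fun_prop (disch := assumption)

lemma hasDerivAt_weierstrassZetaExcept {z : ℂ} (hz : z ∈ ((L.lattice : Set ℂ) \ {0})ᶜ) :
    HasDerivAt L.weierstrassZetaExcept (-℘[L - (0 : ℂ)] z) z := by
  have hd : DifferentiableOn ℂ L.weierstrassZetaExcept ((L.lattice : Set ℂ) \ {0})ᶜ :=
    L.hasSumLocallyUniformly_weierstrassZetaExcept.tendstoLocallyUniformlyOn.differentiableOn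
      (.of_forall fun s ↦ .fun_sum fun l _ ↦ L.differentiableOn_weierstrassZetaExcept_summand l)
      L.isOpen_compl_lattice_sdiff
  have hz' := L.isOpen_compl_lattice_sdiff.mem_nhds hz
  have h := (hd.differentiableAt hz').hasDerivAt
  refine h.congr_deriv <| ((L.hasSumLocallyUniformly_weierstrassZetaExcept.tendstoLocallyUniformlyOn.deriv
    (.of_forall fun s ↦ .fun_sum fun l _ ↦ L.differentiableOn_weierstrassZetaExcept_summand l)
    L.isOpen_compl_lattice_sdiff).unique (g := fun z ↦ -℘[L - (0 : ℂ)] z) ?_) hz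
  refine ((L.hasSumLocallyUniformly_weierstrassPExcept 0).tendstoLocallyUniformlyOn.fun_neg).congr ?_
  intro s x hx
  simp only [Function.comp]
  rw [deriv_fun_sum fun l _ ↦ (L.differentiableOn_weierstrassZetaExcept_summand l).differentiableAt
    (L.isOpen_compl_lattice_sdiff.mem_nhds hx), ← Finset.sum_neg_distrib]
  refine Finset.sum_congr rfl fun l _ ↦ ?_
  split_ifs with h
  · simp
  · have h1 : x - l ≠ 0 := by
      rw [sub_ne_zero]
      rintro rfl
      exact hx ⟨l.2, h⟩
    have h2 := (((((hasDerivAt_id x).sub_const (l : ℂ)).inv h1).add_const (1 / (l : ℂ))).add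
      ((hasDerivAt_id x).div_const ((l : ℂ) ^ 2)))
    simp only [id] at h2
    refine ((h2.congr_of_eventuallyEq (.of_forall fun y ↦ by simp)).deriv.trans ?_).symm
    ring

@[simp]
lemma weierstrassZetaExcept_zero : L.weierstrassZetaExcept 0 = 0 := by
  simp [weierstrassZetaExcept]

lemma weierstrassZetaExcept_neg (z : ℂ) :
    L.weierstrassZetaExcept (-z) = -L.weierstrassZetaExcept z := by
  rw [weierstrassZetaExcept, weierstrassZetaExcept, ← tsum_neg, ← (Equiv.neg _).tsum_eq]
  refine tsum_congr fun l ↦ ?_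
  simp only [Equiv.neg_apply, NegMemClass.coe_neg, neg_eq_zero]
  split_ifs
  · simp
  · rw [show -z - -(l : ℂ) = -(z - l) by ring]
    simp only [one_div, inv_neg, neg_sq]
    ring

lemma weierstrassZeta_neg (z : ℂ) : L.weierstrassZeta (-z) = -L.weierstrassZeta z := by
  rw [weierstrassZeta_eq, weierstrassZeta_eq, weierstrassZetaExcept_neg, div_neg]
  ring

lemma mem_compl_lattice_sdiff {z : ℂ} (hz : z ∉ L.lattice) (s : Set ℂ) :
    z ∈ ((L.lattice : Set ℂ) \ s)ᶜ := fun h ↦ hz h.1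

lemma hasDerivAt_weierstrassZeta {z : ℂ} (hz : z ∉ L.lattice) :
    HasDerivAt L.weierstrassZeta (-℘[L] z) z := by
  have hz0 : z ≠ 0 := fun h ↦ hz (h ▸ zero_mem _)
  rw [funext L.weierstrassZeta_eq]
  have := (hasDerivAt_inv hz0).add
    (L.hasDerivAt_weierstrassZetaExcept (L.mem_compl_lattice_sdiff hz _))
  refine (this.congr_of_eventuallyEq (.of_forall fun y ↦ by simp)).congr_deriv ?_
  rw [← L.weierstrassPExcept_add 0]
  simp

/-- Quasi-periodicity of the Weierstrass zeta function. -/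
lemma weierstrassZeta_add {l : ℂ} (hl : l ∈ L.lattice) (hl2 : l / 2 ∉ L.lattice) {z : ℂ}
    (hz : z ∉ L.lattice) :
    L.weierstrassZeta (z + l) = L.weierstrassZeta z + 2 * L.weierstrassZeta (l / 2) := by
  have hadd {x : ℂ} (hx : x ∉ L.lattice) : x + l ∉ L.lattice := fun h ↦
    hx (by simpa using sub_mem h hl)
  have hopen : IsOpen ((L.lattice : Set ℂ)ᶜ) := L.isClosed_lattice.isOpen_compl
  have h1 {x : ℂ} (hx : x ∉ L.lattice) :
      HasDerivAt (fun z ↦ L.weierstrassZeta (z + l)) (-℘[L] x) x := by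
    have := (L.hasDerivAt_weierstrassZeta (hadd hx)).comp_add_const x l
    rwa [show x + l = x + (⟨l, hl⟩ : L.lattice) from rfl, weierstrassP_add_coe] at this
  have h2 {x : ℂ} (hx : x ∉ L.lattice) :
      HasDerivAt (fun z ↦ L.weierstrassZeta z + 2 * L.weierstrassZeta (l / 2)) (-℘[L] x) x :=
    (L.hasDerivAt_weierstrassZeta hx).add_const _
  -- The complement of a countable set in `ℂ` is connected, so the two sides differ by a constant;
  -- at `-l/2` oddness of `ζ` shows that it is zero.
  refine IsOpen.eqOn_of_deriv_eq (𝕜 := ℂ) (s := (L.lattice : Set ℂ)ᶜ)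
    (f := fun z ↦ L.weierstrassZeta (z + l))
    (g := fun z ↦ L.weierstrassZeta z + 2 * L.weierstrassZeta (l / 2)) hopen ?_
    (fun x hx ↦ (h1 hx).differentiableAt.differentiableWithinAt)
    (fun x hx ↦ (h2 hx).differentiableAt.differentiableWithinAt)
    (fun x hx ↦ (h1 hx).deriv.trans (h2 hx).deriv.symm) (x := -(l / 2)) ?_ ?_ hz
  · refine (Set.Countable.isConnected_compl_of_one_lt_rank (by simp) ?_).isPreconnected
    exact Set.countable_coe_iff.mp (inferInstanceAs (Countable L.lattice))
  · simpa using hl2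
  · simp only [weierstrassZeta_neg]
    rw [show -(l / 2) + l = l / 2 by ring]
    ring

lemma weierstrassZeta_add_ω₁ {z : ℂ} (hz : z ∉ L.lattice) :
    L.weierstrassZeta (z + L.ω₁) = L.weierstrassZeta z + L.η₁ :=
  L.weierstrassZeta_add L.ω₁_mem_lattice L.ω₁_div_two_notMem_lattice hz

lemma weierstrassZeta_add_ω₂ {z : ℂ} (hz : z ∉ L.lattice) :
    L.weierstrassZeta (z + L.ω₂) = L.weierstrassZeta z + L.η₂ :=
  L.weierstrassZeta_add L.ω₂_mem_lattice L.ω₂_div_two_notMem_lattice hz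

/-! ### Legendre's relation by integration around a period parallelogram. -/

lemma ω₁_ne_zero : L.ω₁ ≠ 0 := by simpa using L.indep.ne_zero 0

lemma exists_int_of_mem_lattice {s t : ℝ} (h : s * L.ω₁ + t * L.ω₂ ∈ L.lattice) :
    ∃ m n : ℤ, s = m ∧ t = n := by
  obtain ⟨m, n, e⟩ := mem_lattice.mp h
  have := LinearIndependent.pair_iff.mp L.indep (m - s) (n - t) (by
    simp only [Complex.real_smul]; push_cast; linear_combination e)
  exact ⟨m, n, by linarith [this.1], by linarith [this.2]⟩

/-- Centring the parallelogram at `0` makes the origin its only lattice point, boundary included, so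
the regular part of `ζ` is holomorphic on all of it. -/
lemma eq_zero_of_mem_lattice_of_abs_le {s t : ℝ} (hs : |s| ≤ 1 / 2) (ht : |t| ≤ 1 / 2)
    (h : s * L.ω₁ + t * L.ω₂ ∈ L.lattice) : s = 0 ∧ t = 0 := by
  obtain ⟨m, n, rfl, rfl⟩ := L.exists_int_of_mem_lattice h
  have key (k : ℤ) (hk : |(k : ℝ)| ≤ 1 / 2) : k = 0 := by
    rw [← Int.abs_lt_one_iff]
    have : |(k : ℝ)| < 1 := by linarith
    exact_mod_cast this
  simp [key m hs, key n ht]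

lemma notMem_lattice_of_eq_half {s t : ℝ} (hs : |s| ≤ 1 / 2) (ht : |t| ≤ 1 / 2)
    (h : |s| = 1 / 2 ∨ |t| = 1 / 2) : (s * L.ω₁ + t * L.ω₂ : ℂ) ∉ L.lattice := by
  intro hm
  obtain ⟨rfl, rfl⟩ := L.eq_zero_of_mem_lattice_of_abs_le hs ht hm
  norm_num at h

lemma mem_compl_of_abs_le {s t : ℝ} (hs : |s| ≤ 1 / 2) (ht : |t| ≤ 1 / 2) :
    (s * L.ω₁ + t * L.ω₂ : ℂ) ∈ ((L.lattice : Set ℂ) \ {0})ᶜ := by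
  rintro ⟨hm, h0⟩
  obtain ⟨rfl, rfl⟩ := L.eq_zero_of_mem_lattice_of_abs_le hs ht hm
  simp at h0

/-- Cauchy's theorem for the regular part of `ζ` on the period parallelogram centred at `0`. -/
lemma boundary_integral_weierstrassZetaExcept :
    (∫ x : ℝ in (-(1 / 2))..(1 / 2), -L.ω₁ * L.weierstrassZetaExcept (x * L.ω₁ + (1 / 2 : ℝ) * L.ω₂))
    - (∫ x : ℝ in (-(1 / 2))..(1 / 2),
        -L.ω₁ * L.weierstrassZetaExcept (x * L.ω₁ + (-(1 / 2) : ℝ) * L.ω₂))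
    + (∫ y : ℝ in (-(1 / 2))..(1 / 2), L.ω₂ * L.weierstrassZetaExcept ((1 / 2 : ℝ) * L.ω₁ + y * L.ω₂))
    - (∫ y : ℝ in (-(1 / 2))..(1 / 2),
        L.ω₂ * L.weierstrassZetaExcept ((-(1 / 2) : ℝ) * L.ω₁ + y * L.ω₂)) = 0 := by
  let ℓ : ℝ × ℝ →L[ℝ] ℂ := (ContinuousLinearMap.fst ℝ ℝ ℝ).smulRight L.ω₁ +
    (ContinuousLinearMap.snd ℝ ℝ ℝ).smulRight L.ω₂
  have hℓ (p : ℝ × ℝ) : ℓ p = p.1 * L.ω₁ + p.2 * L.ω₂ := by simp [ℓ]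
  let D (c : ℂ) (p : ℝ × ℝ) : ℝ × ℝ →L[ℝ] ℂ :=
    ((ContinuousLinearMap.toSpanSingleton ℂ (c * -℘[L - (0 : ℂ)] (ℓ p))).restrictScalars ℝ).comp ℓ
  have hD (c : ℂ) (p : ℝ × ℝ) (h1 : |p.1| ≤ 1 / 2) (h2 : |p.2| ≤ 1 / 2) :
      HasFDerivAt (fun p : ℝ × ℝ ↦ c * L.weierstrassZetaExcept (p.1 * L.ω₁ + p.2 * L.ω₂))
        (D c p) p := by
    have h := (L.hasDerivAt_weierstrassZetaExcept (z := ℓ p)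
      (hℓ p ▸ L.mem_compl_of_abs_le h1 h2)).const_mul c
    have := (h.hasFDerivAt.restrictScalars ℝ).comp p ℓ.hasFDerivAt
    refine this.congr_of_eventuallyEq (.of_forall fun q ↦ ?_)
    simp [hℓ]
  have hI : Set.uIcc (-(1 / 2) : ℝ) (1 / 2) = Set.Icc (-(1 / 2)) (1 / 2) :=
    Set.uIcc_of_le (by norm_num)
  have hmin : min (-(1 / 2) : ℝ) (1 / 2) = -(1 / 2) := min_eq_left (by norm_num)
  have hmax : max (-(1 / 2) : ℝ) (1 / 2) = 1 / 2 := max_eq_right (by norm_num)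
  have hcont (c : ℂ) : ContinuousOn
      (fun p : ℝ × ℝ ↦ c * L.weierstrassZetaExcept (p.1 * L.ω₁ + p.2 * L.ω₂))
      (Set.uIcc (-(1 / 2)) (1 / 2) ×ˢ Set.uIcc (-(1 / 2)) (1 / 2)) := by
    intro p hp
    rw [hI] at hp
    exact (hD c p (abs_le.mpr hp.1) (abs_le.mpr hp.2)).continuousAt.continuousWithinAt
  have hderiv (c : ℂ) : ∀ p ∈ Set.Ioo (min (-(1 / 2) : ℝ) (1 / 2)) (max (-(1 / 2)) (1 / 2)) ×ˢ
      Set.Ioo (min (-(1 / 2) : ℝ) (1 / 2)) (max (-(1 / 2)) (1 / 2)),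
      HasFDerivAt (fun p : ℝ × ℝ ↦ c * L.weierstrassZetaExcept (p.1 * L.ω₁ + p.2 * L.ω₂))
        (D c p) p := by
    intro p hp
    rw [hmin, hmax] at hp
    exact hD c p (abs_le.mpr (Set.Ioo_subset_Icc_self hp.1)) (abs_le.mpr (Set.Ioo_subset_Icc_self hp.2))
  -- The field `(ω₂f, -ω₁f)` in the real coordinates of `ℓ` has divergence `ω₂ω₁f' - ω₁ω₂f' = 0`;
  -- Cauchy's theorem thus becomes the divergence theorem on a square.
  have hzero (p : ℝ × ℝ) : D L.ω₂ p (1, 0) + D (-L.ω₁) p (0, 1) = 0 := by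
    simp [D, hℓ]
    ring
  have := MeasureTheory.integral2_divergence_prod_of_hasFDerivAt _ _ (D L.ω₂) (D (-L.ω₁))
    (-(1 / 2)) (-(1 / 2)) (1 / 2) (1 / 2) (hcont _) (hcont _) (hderiv _) (hderiv _)
    (by simp only [hzero]; exact MeasureTheory.integrableOn_zero)
  simp only [hzero, intervalIntegral.integral_zero] at this
  exact this.symm

lemma weierstrassZetaExcept_add_sub {z l η : ℂ} (h : L.weierstrassZeta (z + l) =
    L.weierstrassZeta z + η) :
    L.weierstrassZetaExcept (z + l) - L.weierstrassZetaExcept z = η + 1 / z - 1 / (z + l) := by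
  rw [weierstrassZeta_eq, weierstrassZeta_eq] at h
  linear_combination h

/-- A segment on which the regular part of `ζ` is continuous. -/
lemma intervalIntegrable_weierstrassZetaExcept (c a b : ℂ)
    (h : ∀ x : ℝ, |x| ≤ 1 / 2 → a * x + b ∈ ((L.lattice : Set ℂ) \ {0})ᶜ) :
    IntervalIntegrable (fun x : ℝ ↦ c * L.weierstrassZetaExcept (a * x + b))
      MeasureTheory.volume (-(1 / 2)) (1 / 2) := by
  refine ContinuousOn.intervalIntegrable fun x hx ↦ ?_
  rw [Set.uIcc_of_le (by norm_num)] at hx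
  have h1 := (L.hasDerivAt_weierstrassZetaExcept (h x (abs_le.mpr hx))).continuousAt
  have h2 : ContinuousAt (fun x : ℝ ↦ a * x + b) x := by fun_prop
  exact (continuousAt_const.mul (ContinuousAt.comp (f := fun x : ℝ ↦ a * x + b) h1 h2)).continuousWithinAt

end PeriodPair

lemma Complex.log_neg_of_im_pos {u : ℂ} (hu : 0 < u.im) :
    Complex.log (-u) = Complex.log u - Real.pi * Complex.I := by
  rw [Complex.log, Complex.log, norm_neg, Complex.arg_neg_eq_arg_sub_pi_of_im_pos hu]
  push_cast
  ring

lemma Complex.log_neg_of_im_neg {u : ℂ} (hu : u.im < 0) :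
    Complex.log (-u) = Complex.log u + Real.pi * Complex.I := by
  rw [Complex.log, Complex.log, norm_neg, Complex.arg_neg_eq_arg_add_pi_of_im_neg hu]
  push_cast
  ring

lemma integral_inv_sub_inv_of_im_ne_zero {τ : ℂ} (hτ : τ.im ≠ 0) (η : ℂ) :
    ∫ x : ℝ in (-(1 / 2))..(1 / 2), (η + 1 / (x - τ / 2) - 1 / (x + τ / 2)) =
      η + (Complex.log (1 / 2 - τ / 2) - Complex.log (1 / 2 + τ / 2))
        - (Complex.log (-(1 / 2 + τ / 2)) - Complex.log (-(1 / 2 - τ / 2))) := by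
  have hs1 (x : ℝ) : (x - τ / 2 : ℂ) ∈ Complex.slitPlane := by
    right; simpa using hτ
  have hs2 (x : ℝ) : (x + τ / 2 : ℂ) ∈ Complex.slitPlane := by
    right; simpa using hτ
  have hd (x : ℝ) : HasDerivAt (fun x : ℝ ↦ η * x + Complex.log (x - τ / 2) - Complex.log (x + τ / 2))
      (η + 1 / (x - τ / 2) - 1 / (x + τ / 2)) x := by
    have e : HasDerivAt (fun x : ℝ ↦ (x : ℂ)) 1 x := Complex.ofRealCLM.hasDerivAt
    have := ((e.const_mul η).add ((e.sub_const (τ / 2)).clog_real (hs1 x))).sub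
      ((e.add_const (τ / 2)).clog_real (hs2 x))
    exact this.congr_deriv (by simp)
  rw [intervalIntegral.integral_eq_sub_of_hasDerivAt (fun x _ ↦ hd x)]
  · push_cast
    rw [show -(1 / 2 : ℂ) - τ / 2 = -(1 / 2 + τ / 2) by ring,
      show -(1 / 2 : ℂ) + τ / 2 = -(1 / 2 - τ / 2) by ring]
    ring
  · refine ContinuousOn.intervalIntegrable fun x _ ↦ ContinuousAt.continuousWithinAt ?_
    have h1 := Complex.slitPlane_ne_zero (hs1 x)
    have h2 := Complex.slitPlane_ne_zero (hs2 x)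
    fun_prop (disch := assumption)

/-- The primitive uses `log (1/2 ∓ τy)`: these arguments cross the real axis only at `1/2`, whereas
`τy - 1/2` would meet the branch cut at `y = 0`. -/
lemma integral_mul_inv_sub_inv_of_im_ne_zero {τ : ℂ} (hτ : τ.im ≠ 0) (η : ℂ) :
    ∫ y : ℝ in (-(1 / 2))..(1 / 2), (η + τ / (τ * y - 1 / 2) - τ / (τ * y + 1 / 2)) =
      η + 2 * (Complex.log (1 / 2 - τ / 2) - Complex.log (1 / 2 + τ / 2)) := by
  have hs1 (x : ℝ) : (1 / 2 - τ * x : ℂ) ∈ Complex.slitPlane := by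
    by_cases hx : x = 0
    · left; simp [hx]
    · right; simp [hτ, hx]
  have hs2 (x : ℝ) : (1 / 2 + τ * x : ℂ) ∈ Complex.slitPlane := by
    by_cases hx : x = 0
    · left; simp [hx]
    · right; simp [hτ, hx]
  have hd (x : ℝ) : HasDerivAt
      (fun x : ℝ ↦ η * x + Complex.log (1 / 2 - τ * x) - Complex.log (1 / 2 + τ * x))
      (η + -(τ * 1) / (1 / 2 - τ * x) - (τ * 1) / (1 / 2 + τ * x)) x := by
    have e : HasDerivAt (fun x : ℝ ↦ (x : ℂ)) 1 x := Complex.ofRealCLM.hasDerivAt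
    have := ((e.const_mul η).add (((e.const_mul τ).const_sub (1 / 2)).clog_real (hs1 x))).sub
      (((e.const_mul τ).const_add (1 / 2)).clog_real (hs2 x))
    exact this.congr_deriv (by ring)
  rw [intervalIntegral.integral_congr
    (g := fun x : ℝ ↦ η + -(τ * 1) / (1 / 2 - τ * x) - (τ * 1) / (1 / 2 + τ * x)),
    intervalIntegral.integral_eq_sub_of_hasDerivAt (fun x _ ↦ hd x)]
  · push_cast
    rw [show 1 / 2 - τ * (1 / 2) = 1 / 2 - τ / 2 by ring, show 1 / 2 + τ * (1 / 2) = 1 / 2 + τ / 2 by ring,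
      show 1 / 2 - τ * -(1 / 2) = 1 / 2 + τ / 2 by ring,
      show 1 / 2 + τ * -(1 / 2) = 1 / 2 - τ / 2 by ring]
    ring
  · refine ContinuousOn.intervalIntegrable fun x _ ↦ ContinuousAt.continuousWithinAt ?_
    have h1 := Complex.slitPlane_ne_zero (hs1 x)
    have h2 := Complex.slitPlane_ne_zero (hs2 x)
    fun_prop (disch := assumption)
  · intro x _
    simp only [mul_one]
    rw [← neg_sub (τ * (x : ℂ)) (1 / 2), neg_div_neg_eq, add_comm (τ * (x : ℂ)) (1 / 2)]

namespace PeriodPair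

variable (L : PeriodPair)

/-- **Legendre's relation** between the periods and the quasi-periods. -/
theorem legendre_relation (hL : 0 < (L.ω₂ / L.ω₁).im) :
    L.η₁ * L.ω₂ - L.η₂ * L.ω₁ = 2 * Real.pi * Complex.I := by
  have h1 := L.ω₁_ne_zero
  set τ := L.ω₂ / L.ω₁ with hτ
  have hω : L.ω₂ = τ * L.ω₁ := by rw [hτ]; field_simp
  have hhalf : |(1 / 2 : ℝ)| = 1 / 2 := abs_of_pos (by norm_num)
  have hhalf' : |(-(1 / 2) : ℝ)| = 1 / 2 := by rw [abs_neg, hhalf]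
  have hH : (∫ x : ℝ in (-(1 / 2))..(1 / 2),
        -L.ω₁ * L.weierstrassZetaExcept (x * L.ω₁ + (1 / 2 : ℝ) * L.ω₂))
      - (∫ x : ℝ in (-(1 / 2))..(1 / 2),
        -L.ω₁ * L.weierstrassZetaExcept (x * L.ω₁ + (-(1 / 2) : ℝ) * L.ω₂)) =
      -∫ x : ℝ in (-(1 / 2))..(1 / 2), (L.η₂ * L.ω₁ + 1 / (x - τ / 2) - 1 / (x + τ / 2)) := by
    rw [← intervalIntegral.integral_sub, ← intervalIntegral.integral_neg]
    · refine intervalIntegral.integral_congr fun x hx ↦ ?_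
      rw [Set.uIcc_of_le (by norm_num)] at hx
      have hm := L.notMem_lattice_of_eq_half (abs_le.mpr hx) hhalf'.le (.inr hhalf')
      have h := L.weierstrassZetaExcept_add_sub (L.weierstrassZeta_add_ω₂ hm)
      rw [show x * L.ω₁ + (-(1 / 2) : ℝ) * L.ω₂ + L.ω₂ = x * L.ω₁ + (1 / 2 : ℝ) * L.ω₂ by
        push_cast; ring] at h
      have e1 : 1 / (x - τ / 2 : ℂ) = L.ω₁ * (1 / (x * L.ω₁ + (-(1 / 2) : ℝ) * L.ω₂)) := by
        rw [hω, show x * L.ω₁ + (-(1 / 2) : ℝ) * (τ * L.ω₁) = L.ω₁ * (x - τ / 2) by push_cast; ring,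
          one_div, one_div, mul_inv, mul_inv_cancel_left₀ h1]
      have e2 : 1 / (x + τ / 2 : ℂ) = L.ω₁ * (1 / (x * L.ω₁ + (1 / 2 : ℝ) * L.ω₂)) := by
        rw [hω, show x * L.ω₁ + (1 / 2 : ℝ) * (τ * L.ω₁) = L.ω₁ * (x + τ / 2) by push_cast; ring,
          one_div, one_div, mul_inv, mul_inv_cancel_left₀ h1]
      simp only [e1, e2]
      linear_combination -L.ω₁ * h
    all_goals
      simp only [mul_comm _ L.ω₁]
      refine L.intervalIntegrable_weierstrassZetaExcept _ _ _ fun x hx ↦ ?_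
      rw [mul_comm L.ω₁]
    · exact L.mem_compl_of_abs_le hx hhalf.le
    · exact L.mem_compl_of_abs_le hx hhalf'.le
  have hV : (∫ y : ℝ in (-(1 / 2))..(1 / 2),
        L.ω₂ * L.weierstrassZetaExcept ((1 / 2 : ℝ) * L.ω₁ + y * L.ω₂))
      - (∫ y : ℝ in (-(1 / 2))..(1 / 2),
        L.ω₂ * L.weierstrassZetaExcept ((-(1 / 2) : ℝ) * L.ω₁ + y * L.ω₂)) =
      ∫ y : ℝ in (-(1 / 2))..(1 / 2),
        (L.η₁ * L.ω₂ + τ / (τ * y - 1 / 2) - τ / (τ * y + 1 / 2)) := by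
    rw [← intervalIntegral.integral_sub]
    · refine intervalIntegral.integral_congr fun y hy ↦ ?_
      rw [Set.uIcc_of_le (by norm_num)] at hy
      have hm := L.notMem_lattice_of_eq_half hhalf'.le (abs_le.mpr hy) (.inl hhalf')
      have h := L.weierstrassZetaExcept_add_sub (L.weierstrassZeta_add_ω₁ hm)
      rw [show (-(1 / 2) : ℝ) * L.ω₁ + y * L.ω₂ + L.ω₁ = (1 / 2 : ℝ) * L.ω₁ + y * L.ω₂ by
        push_cast; ring] at h
      have e1 : τ / (τ * y - 1 / 2 : ℂ) = L.ω₂ * (1 / ((-(1 / 2) : ℝ) * L.ω₁ + y * L.ω₂)) := by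
        rw [hω, show (-(1 / 2) : ℝ) * L.ω₁ + y * (τ * L.ω₁) = L.ω₁ * (τ * y - 1 / 2) by
          push_cast; ring, mul_comm τ L.ω₁, mul_assoc, mul_one_div, mul_div_assoc',
          mul_div_mul_left _ _ h1]
      have e2 : τ / (τ * y + 1 / 2 : ℂ) = L.ω₂ * (1 / ((1 / 2 : ℝ) * L.ω₁ + y * L.ω₂)) := by
        rw [hω, show (1 / 2 : ℝ) * L.ω₁ + y * (τ * L.ω₁) = L.ω₁ * (τ * y + 1 / 2) by
          push_cast; ring, mul_comm τ L.ω₁, mul_assoc, mul_one_div, mul_div_assoc',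
          mul_div_mul_left _ _ h1]
      simp only [e1, e2]
      linear_combination L.ω₂ * h
    all_goals
      simp only [mul_comm _ L.ω₂, add_comm (_ * L.ω₁)]
      refine L.intervalIntegrable_weierstrassZetaExcept _ _ _ fun x hx ↦ ?_
      rw [mul_comm L.ω₂, add_comm]
    · exact L.mem_compl_of_abs_le hhalf.le hx
    · exact L.mem_compl_of_abs_le hhalf'.le hx
  -- All logarithms cancel between the two pairs of sides except for the two branch jumps of `πi`,
  -- which produce `2πi`.
  have key := L.boundary_integral_weierstrassZetaExcept
  rw [add_sub_assoc, hH, hV, integral_inv_sub_inv_of_im_ne_zero hL.ne',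
    integral_mul_inv_sub_inv_of_im_ne_zero hL.ne', Complex.log_neg_of_im_pos (by simpa using hL),
    Complex.log_neg_of_im_neg (by simpa using hL)] at key
  linear_combination key

/-! ### Termwise differentiation in the first period. -/

/-- The real coordinate of a complex number along the first period. -/
def coordω₁ : ℂ →L[ℝ] ℝ := LinearMap.toContinuousLinearMap (L.basis.coord 0)

@[simp]
lemma coordω₁_ω₁ : L.coordω₁ L.ω₁ = 1 := by
  simp [coordω₁, ← basis_zero]

@[simp]
lemma coordω₁_ω₂ : L.coordω₁ L.ω₂ = 0 := by
  simp [coordω₁, ← basis_one]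

lemma coordω₁_add_mul (s t : ℝ) : L.coordω₁ (s * L.ω₁ + t * L.ω₂) = s := by
  rw [map_add, ← Complex.real_smul, ← Complex.real_smul, map_smul, map_smul]
  simp

lemma coordω₁_intCast (m n : ℤ) : L.coordω₁ (m * L.ω₁ + n * L.ω₂) = m := by
  simpa using L.coordω₁_add_mul m n

/-- The derivative of `℘` with respect to the first period, as a sum over the lattice. -/
def weierstrassPDerivω₁ (z : ℂ) : ℂ :=
  ∑' l : L.lattice, (L.coordω₁ l : ℂ) * (2 / (z - l) ^ 3 + 2 / (l : ℂ) ^ 3)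

lemma norm_one_div_sub_sq_sub_le {z a : ℂ} {ρ : ℝ} (hρ : 0 < ρ) (ha : ρ ≤ ‖a‖) (hz : ρ ≤ ‖z - a‖) :
    ‖1 / (z - a) ^ 2 - 1 / a ^ 2‖ ≤ 2 * ‖z‖ / ρ ^ 3 := by
  have ha0 : a ≠ 0 := norm_pos_iff.mp (hρ.trans_le ha)
  have hz0 : z - a ≠ 0 := norm_pos_iff.mp (hρ.trans_le hz)
  have e : 1 / (z - a) ^ 2 - 1 / a ^ 2 = z / (a * (z - a) ^ 2) - z / (a ^ 2 * (z - a)) := by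
    field_simp
    ring
  rw [e]
  refine (norm_sub_le _ _).trans ?_
  simp only [norm_div, norm_mul, norm_pow]
  calc ‖z‖ / (‖a‖ * ‖z - a‖ ^ 2) + ‖z‖ / (‖a‖ ^ 2 * ‖z - a‖)
      ≤ ‖z‖ / (ρ * ρ ^ 2) + ‖z‖ / (ρ ^ 2 * ρ) := by gcongr
    _ = _ := by ring

/-- Off the lattice, `‖l - z‖` is comparable to `‖l‖` for nonzero lattice points `l`. -/
lemma exists_norm_le_mul_norm_sub {z : ℂ} (hz : z ∉ L.lattice) :
    ∃ K : ℝ, 1 ≤ K ∧ ∀ l ∈ L.lattice, ‖l‖ ≤ K * ‖l - z‖ ∧ (l ≠ 0 → ‖l - z‖ ≤ K * ‖l‖) := by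
  obtain ⟨d, hd, hd'⟩ := Metric.isOpen_iff.mp L.isClosed_lattice.isOpen_compl z hz
  obtain ⟨e, he, he'⟩ := Metric.mem_nhds_iff.mp (L.compl_lattice_sdiff_singleton_mem_nhds 0)
  refine ⟨1 + ‖z‖ / d + ‖z‖ / e, by have : 0 ≤ ‖z‖ / d + ‖z‖ / e := by positivity
                                    linarith, fun l hl ↦ ⟨?_, fun hl0 ↦ ?_⟩⟩
  · have h1 : d ≤ ‖l - z‖ := by
      by_contra! h
      exact hd' (mem_ball_iff_norm.mpr h) hl
    have h2 : ‖l‖ ≤ ‖l - z‖ + ‖z‖ := by simpa using norm_add_le (l - z) z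
    have h3 : ‖z‖ ≤ ‖z‖ / d * ‖l - z‖ := by
      rw [div_mul_eq_mul_div, le_div_iff₀ hd]
      gcongr
    have h4 : 0 ≤ ‖z‖ / e * ‖l - z‖ := by positivity
    linarith
  · have h1 : e ≤ ‖l‖ := by
      by_contra! h
      exact he' (mem_ball_zero_iff.mpr h) ⟨hl, hl0⟩
    have h2 : ‖l - z‖ ≤ ‖l‖ + ‖z‖ := norm_sub_le _ _
    have h3 : ‖z‖ ≤ ‖z‖ / e * ‖l‖ := by
      rw [div_mul_eq_mul_div, le_div_iff₀ he]
      gcongr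
    have h4 : 0 ≤ ‖z‖ / d * ‖l‖ := by positivity
    linarith

/-- Indexing by the fixed lattice of `L` rather than by the lattice of `(w, ω₂)` leaves `w` only in
the summands. -/
lemma weierstrassPFun_eq_tsum (z w : ℂ) (h : LinearIndependent ℝ ![w, L.ω₂]) :
    weierstrassPFun z w L.ω₂ = ∑' l : L.lattice,
      (1 / (z - (l + (w - L.ω₁) * L.coordω₁ l)) ^ 2 - 1 / (l + (w - L.ω₁) * L.coordω₁ l) ^ 2) := by
  rw [weierstrassPFun_eq ⟨w, L.ω₂, h⟩, weierstrassP,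
    ← (PeriodPair.latticeEquivProd ⟨w, L.ω₂, h⟩).symm.toEquiv.tsum_eq,
    ← L.latticeEquivProd.symm.toEquiv.tsum_eq]
  refine tsum_congr fun p ↦ ?_
  simp only [LinearEquiv.coe_toEquiv, latticeEquiv_symm_apply, coordω₁_intCast]
  push_cast
  ring_nf

/-- Uniform estimates for a small perturbation of the first period. -/
lemma exists_pos_bound {z : ℂ} (hz : z ∉ L.lattice) :
    ∃ δ > 0, ∃ C : ℝ, (∀ w ∈ Metric.ball L.ω₁ δ, LinearIndependent ℝ ![w, L.ω₂]) ∧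
      ∀ l : L.lattice, ∀ w ∈ Metric.ball L.ω₁ δ,
        z - (l + (w - L.ω₁) * L.coordω₁ l) ≠ 0 ∧
        ((l : ℂ) ≠ 0 → (l + (w - L.ω₁) * L.coordω₁ l : ℂ) ≠ 0) ∧
        ‖1 / (z - (l + (w - L.ω₁) * L.coordω₁ l)) ^ 2 - 1 / (l + (w - L.ω₁) * L.coordω₁ l) ^ 2‖
          ≤ C * ‖(l : ℂ) - z‖ ^ (-3 : ℝ) := by
  obtain ⟨K, hK1, hK⟩ := L.exists_norm_le_mul_norm_sub hz
  have hφ : 0 ≤ ‖L.coordω₁‖ := norm_nonneg _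
  -- With this radius the displacement of `l` is at most `‖l‖/(2K)`, hence at most half of both
  -- `‖l‖` and `‖l - z‖`.
  let δ : ℝ := 1 / (2 * K * (‖L.coordω₁‖ + 1))
  have hδ : 0 < δ := by positivity
  have hpert {w : ℂ} (hw : w ∈ Metric.ball L.ω₁ δ) (x : ℂ) :
      ‖(w - L.ω₁) * L.coordω₁ x‖ ≤ ‖x‖ / (2 * K) := by
    rw [norm_mul, Complex.norm_real]
    calc ‖w - L.ω₁‖ * ‖L.coordω₁ x‖ ≤ δ * ((‖L.coordω₁‖ + 1) * ‖x‖) := by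
          gcongr
          · exact (mem_ball_iff_norm.mp hw).le
          · exact (L.coordω₁.le_opNorm x).trans (by gcongr; linarith)
      _ = ‖x‖ / (2 * K) := by simp only [δ]; field
  have hhalf (x : ℂ) : ‖x‖ / (2 * K) ≤ ‖x‖ / 2 := by gcongr; linarith
  have hlower {w : ℂ} (hw : w ∈ Metric.ball L.ω₁ δ) (x : ℂ) :
      ‖x‖ / 2 ≤ ‖x + (w - L.ω₁) * L.coordω₁ x‖ := by
    have h1 := norm_sub_norm_le x (-((w - L.ω₁) * L.coordω₁ x))
    rw [norm_neg, sub_neg_eq_add] at h1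
    linarith [hpert hw x, hhalf x]
  have hpos (l : L.lattice) : 0 < ‖(l : ℂ) - z‖ := by
    rw [norm_pos_iff, sub_ne_zero]
    rintro rfl
    exact hz l.2
  have hlowerz (l : L.lattice) {w : ℂ} (hw : w ∈ Metric.ball L.ω₁ δ) :
      ‖(l : ℂ) - z‖ / 2 ≤ ‖z - (l + (w - L.ω₁) * L.coordω₁ l)‖ := by
    have h1 := norm_sub_norm_le (z - l) ((w - L.ω₁) * L.coordω₁ l)
    rw [← norm_sub_rev (l : ℂ) z, sub_sub] at h1
    have h2 : ‖(l : ℂ)‖ / (2 * K) ≤ ‖(l : ℂ) - z‖ / 2 := by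
      rw [div_le_div_iff₀ (by positivity) (by positivity)]
      linarith [(hK l l.2).1]
    linarith [hpert hw l]
  -- The constant is `2‖z‖/ρ³` with `ρ = ‖l - z‖/(2K)`. A bound by `‖l‖ ^ (-3)` would fail at `l =
  -- 0`, where that power is `0` by convention but the summand is `1/z²`.
  refine ⟨δ, hδ, 2 * ‖z‖ * (2 * K) ^ 3, fun w hw ↦ ?_, fun l w hw ↦ ⟨?_, fun hl ↦ ?_, ?_⟩⟩
  · refine LinearIndependent.pair_iff.mpr fun s t hst ↦ ?_
    have h1 := hlower hw (s * L.ω₁ + t * L.ω₂)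
    rw [coordω₁_add_mul, show (s * L.ω₁ + t * L.ω₂ + (w - L.ω₁) * s : ℂ) = s * w + t * L.ω₂ by ring,
      ← Complex.real_smul, ← Complex.real_smul, ← Complex.real_smul, hst, norm_zero] at h1
    exact LinearIndependent.pair_iff.mp L.indep s t (norm_le_zero_iff.mp (by linarith))
  · exact norm_pos_iff.mp (by linarith [hlowerz l hw, hpos l])
  · exact norm_pos_iff.mp (by linarith [hlower hw l, norm_pos_iff.mpr hl])
  · have hrpow : ‖(l : ℂ) - z‖ ^ (-3 : ℝ) = 1 / ‖(l : ℂ) - z‖ ^ 3 := by norm_cast; simp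
    rw [hrpow]
    by_cases hl : (l : ℂ) = 0
    · have hz0 : 0 < ‖z‖ := by simpa [hl] using hpos l
      have h8 : 1 ≤ (2 * K) ^ 3 := one_le_pow₀ (by linarith)
      simp only [hl, map_zero, Complex.ofReal_zero, mul_zero, add_zero, sub_zero, zero_sub, norm_neg]
      rw [zero_pow two_ne_zero, div_zero, sub_zero, norm_div, norm_one, norm_pow]
      calc 1 / ‖z‖ ^ 2 = 1 * ‖z‖ * 1 * (1 / ‖z‖ ^ 3) := by field
        _ ≤ _ := by gcongr; norm_num
    · have hD := hpos l
      refine (norm_one_div_sub_sq_sub_le (ρ := ‖(l : ℂ) - z‖ / (2 * K)) (by positivity) ?_ ?_).trans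
        (le_of_eq ?_)
      · refine le_trans ?_ (hlower hw l)
        rw [div_le_div_iff₀ (by positivity) (by positivity)]
        linarith [(hK l l.2).2 hl]
      · exact (hhalf _).trans (hlowerz l hw)
      · field

lemma hasDerivAt_weierstrassPFun_ω₁ {z : ℂ} (hz : z ∉ L.lattice) :
    HasDerivAt (fun w ↦ weierstrassPFun z w L.ω₂) (L.weierstrassPDerivω₁ z) L.ω₁ := by
  obtain ⟨δ, hδ, C, hind, hb⟩ := L.exists_pos_bound hz
  let F (l : L.lattice) (w : ℂ) : ℂ :=
    1 / (z - (l + (w - L.ω₁) * L.coordω₁ l)) ^ 2 - 1 / (l + (w - L.ω₁) * L.coordω₁ l) ^ 2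
  have hF (l : L.lattice) {w : ℂ} (hw : w ∈ Metric.ball L.ω₁ δ) :
      HasDerivAt (F l) (L.coordω₁ l * (2 / (z - (l + (w - L.ω₁) * L.coordω₁ l)) ^ 3
        + 2 / (l + (w - L.ω₁) * L.coordω₁ l) ^ 3)) w := by
    obtain ⟨h1, h2, -⟩ := hb l w hw
    by_cases hl : (l : ℂ) = 0
    · have : F l = fun _ ↦ 1 / z ^ 2 := by
        ext w
        simp [F, hl]
      rw [this]
      simpa [hl] using hasDerivAt_const w (z ^ 2)⁻¹
    · have h2 := h2 hl
      have hT : HasDerivAt (fun w : ℂ ↦ (l : ℂ) + (w - L.ω₁) * L.coordω₁ l) (L.coordω₁ l) w := by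
        simpa using (((hasDerivAt_id w).sub_const L.ω₁).mul_const (L.coordω₁ l : ℂ)).const_add (l : ℂ)
      have h3 := ((((hT.const_sub z).fun_pow 2).fun_inv (pow_ne_zero 2 h1))).fun_sub
        ((hT.fun_pow 2).fun_inv (pow_ne_zero 2 h2))
      refine (h3.congr_of_eventuallyEq (.of_forall fun y ↦ by simp [F])).congr_deriv ?_
      field_simp
      ring
  have hsum : Summable fun l : L.lattice ↦ C * ‖(l : ℂ) - z‖ ^ (-3 : ℝ) :=
    (ZLattice.summable_norm_sub_rpow L.lattice (-3) (by simp; norm_num) z).mul_left C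
  have hdiff (l : L.lattice) : DifferentiableOn ℂ (F l) (Metric.ball L.ω₁ δ) := fun w hw ↦
    (hF l hw).differentiableAt.differentiableWithinAt
  have hmem : L.ω₁ ∈ Metric.ball L.ω₁ δ := Metric.mem_ball_self hδ
  have h1 := Complex.differentiableOn_tsum_of_summable_norm hsum hdiff Metric.isOpen_ball
    fun l w hw ↦ (hb l w hw).2.2
  have h2 := Complex.hasSum_deriv_of_summable_norm hsum hdiff Metric.isOpen_ball
    (fun l w hw ↦ (hb l w hw).2.2) hmem
  have h3 := (h1.differentiableAt (Metric.ball_mem_nhds _ hδ)).hasDerivAt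
  have e : deriv (fun w ↦ ∑' l, F l w) L.ω₁ = L.weierstrassPDerivω₁ z := by
    rw [← h2.tsum_eq, weierstrassPDerivω₁]
    refine tsum_congr fun l ↦ ?_
    rw [(hF l hmem).deriv]
    simp
  rw [e] at h3
  refine h3.congr_of_eventuallyEq ?_
  filter_upwards [Metric.ball_mem_nhds _ hδ] with w hw
  exact L.weierstrassPFun_eq_tsum z w (hind w hw)

/-! ### The derivative series as a function of `z`. -/

lemma weierstrassPDerivω₁_bound {r : ℝ} {s l : ℂ} (hr : 0 < r) (hs : ‖s‖ < r) (h : 2 * r ≤ ‖l‖) :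
    ‖(L.coordω₁ l : ℂ) * (2 / (s - l) ^ 3 + 2 / l ^ 3)‖ ≤
      76 * ‖L.coordω₁‖ * r * ‖l‖ ^ (-3 : ℝ) := by
  have hl : 0 < ‖l‖ := by linarith
  have hl0 : l ≠ 0 := norm_pos_iff.mp hl
  have hsl : ‖l‖ / 2 ≤ ‖s - l‖ := by
    have := norm_sub_norm_le l s
    rw [norm_sub_rev] at this
    linarith
  have hsl' : ‖s - l‖ ≤ 3 / 2 * ‖l‖ := by linarith [norm_sub_le s l]
  have hsl0 : s - l ≠ 0 := norm_pos_iff.mp (by linarith)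
  -- The sum of cubes has the factor `s`, which gains one power of `l` and offsets the linear growth
  -- of `coordω₁`. The constant is `76 = 2 · (19/4) · 2³`.
  have e : 2 / (s - l) ^ 3 + 2 / l ^ 3 =
      2 * s * (l ^ 2 - l * (s - l) + (s - l) ^ 2) / ((s - l) ^ 3 * l ^ 3) := by
    field_simp
    ring
  have hnum : ‖l ^ 2 - l * (s - l) + (s - l) ^ 2‖ ≤ 19 / 4 * ‖l‖ ^ 2 := by
    calc ‖l ^ 2 - l * (s - l) + (s - l) ^ 2‖ ≤ ‖l‖ ^ 2 + ‖l‖ * ‖s - l‖ + ‖s - l‖ ^ 2 := by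
          refine (norm_add_le _ _).trans ?_
          rw [norm_pow (s - l)]
          gcongr
          refine (norm_sub_le _ _).trans ?_
          rw [norm_pow, norm_mul]
      _ ≤ ‖l‖ ^ 2 + ‖l‖ * (3 / 2 * ‖l‖) + (3 / 2 * ‖l‖) ^ 2 := by gcongr
      _ = 19 / 4 * ‖l‖ ^ 2 := by ring
  rw [e, norm_mul, norm_div, norm_mul, norm_mul, norm_mul, norm_pow, norm_pow, Complex.norm_real,
    Complex.norm_ofNat]
  calc ‖L.coordω₁ l‖ * (2 * ‖s‖ * ‖l ^ 2 - l * (s - l) + (s - l) ^ 2‖ / (‖s - l‖ ^ 3 * ‖l‖ ^ 3))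
      ≤ (‖L.coordω₁‖ * ‖l‖) * (2 * r * (19 / 4 * ‖l‖ ^ 2) / ((‖l‖ / 2) ^ 3 * ‖l‖ ^ 3)) := by
        gcongr
        exact L.coordω₁.le_opNorm l
    _ = 76 * ‖L.coordω₁‖ * r / ‖l‖ ^ 3 := by field
    _ = _ := by norm_cast

lemma hasSumLocallyUniformly_weierstrassPDerivω₁ :
    HasSumLocallyUniformly (fun (l : L.lattice) (z : ℂ) ↦
      (L.coordω₁ l : ℂ) * (2 / (z - l) ^ 3 + 2 / (l : ℂ) ^ 3)) L.weierstrassPDerivω₁ := by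
  refine L.hasSumLocallyUniformly_aux (u := (76 * ‖L.coordω₁‖ * · * ‖·‖ ^ (-3 : ℝ))) _
    (fun _ _ ↦ (ZLattice.summable_norm_rpow _ _ (by simp; norm_num)).mul_left _) fun r hr ↦
    Filter.eventually_atTop.mpr ⟨2 * r, ?_⟩
  rintro _ h s hs l rfl
  exact L.weierstrassPDerivω₁_bound hr hs h

lemma hasSum_weierstrassPDerivω₁ (z : ℂ) :
    HasSum (fun l : L.lattice ↦ (L.coordω₁ l : ℂ) * (2 / (z - l) ^ 3 + 2 / (l : ℂ) ^ 3))
      (L.weierstrassPDerivω₁ z) :=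
  L.hasSumLocallyUniformly_weierstrassPDerivω₁.hasSum

lemma differentiableOn_weierstrassPDerivω₁ :
    DifferentiableOn ℂ L.weierstrassPDerivω₁ ((L.lattice : Set ℂ) \ {0})ᶜ := by
  refine L.hasSumLocallyUniformly_weierstrassPDerivω₁.tendstoLocallyUniformlyOn.differentiableOn
    (.of_forall fun s ↦ .fun_sum fun l _ ↦ ?_) L.isOpen_compl_lattice_sdiff
  by_cases hl : (l : ℂ) = 0
  · simp [hl]
  · intro x hx
    have : (x - l) ^ 3 ≠ 0 := by
      refine pow_ne_zero _ (sub_ne_zero.mpr ?_)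
      rintro rfl
      exact hx ⟨l.2, hl⟩
    fun_prop (disch := assumption)

@[simp]
lemma weierstrassPDerivω₁_zero : L.weierstrassPDerivω₁ 0 = 0 := by
  refine (tsum_congr fun l ↦ ?_).trans tsum_zero
  rw [zero_sub, Odd.neg_pow (by decide), div_neg]
  simp

/-- Reindexing leaves `∑ (h(l + l₀) - h(l))`. Since `h` is only of order `|l|⁻²`, this cannot be
split into two absolutely convergent sums; but `h` is even, so `l ↦ -l₀ - l` reverses the sign of
every term and the sum is `0`. -/
lemma weierstrassPDerivω₁_add (z : ℂ) (l₀ : L.lattice) :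
    L.weierstrassPDerivω₁ (z + l₀) = L.weierstrassPDerivω₁ z - L.coordω₁ l₀ * ℘'[L] z := by
  let h (l : L.lattice) : ℂ := 2 * L.coordω₁ l / (l : ℂ) ^ 3
  have h1 : HasSum (fun l : L.lattice ↦
      (L.coordω₁ (l + l₀ : L.lattice) : ℂ) * (2 / (z + l₀ - (l + l₀ : L.lattice)) ^ 3
        + 2 / ((l + l₀ : L.lattice) : ℂ) ^ 3)) (L.weierstrassPDerivω₁ (z + l₀)) := by
    have := (Equiv.addRight l₀).hasSum_iff.mpr (L.hasSum_weierstrassPDerivω₁ (z + l₀))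
    simpa only [Function.comp_def, Equiv.coe_addRight] using this
  have h2 : HasSum (fun l : L.lattice ↦ h (l + l₀) - h l) (L.weierstrassPDerivω₁ (z + l₀) -
      L.weierstrassPDerivω₁ z + L.coordω₁ l₀ * ℘'[L] z) := by
    convert! (h1.sub (L.hasSum_weierstrassPDerivω₁ z)).add
      ((L.hasSum_derivWeierstrassP z).mul_left (L.coordω₁ l₀ : ℂ)) using 2 with l
    simp only [h, Submodule.coe_add, map_add, add_sub_add_right_eq_sub]
    push_cast
    ring
  have hneg (l : L.lattice) : h (-l) = h l := by
    simp only [h, NegMemClass.coe_neg, map_neg]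
    rw [Odd.neg_pow (by decide), Complex.ofReal_neg, mul_neg, neg_div_neg_eq]
  have h3 : HasSum (fun l : L.lattice ↦ -(h (l + l₀) - h l)) (L.weierstrassPDerivω₁ (z + l₀) -
      L.weierstrassPDerivω₁ z + L.coordω₁ l₀ * ℘'[L] z) := by
    convert! (Equiv.subLeft (-l₀)).hasSum_iff.mpr h2 using 2 with l
    simp only [Function.comp, Equiv.subLeft_apply]
    rw [show -l₀ - l + l₀ = -l by abel, show -l₀ - l = -(l + l₀) by abel, hneg, hneg]
    ring
  have h4 := h2.neg.unique h3
  rw [neg_eq_self] at h4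
  linear_combination h4

end PeriodPair

/-! ### Expansions at the origin. -/

/-- If the derivative of `f` is `o(z ^ n)` at the origin and `f 0 = 0`, then `f` is
`o(z ^ (n + 1))`. -/
lemma isLittleO_pow_succ_of_hasDerivAt {f g : ℂ → ℂ} {n : ℕ}
    (hf : ∀ᶠ z in 𝓝 0, HasDerivAt f (g z) z) (h0 : f 0 = 0)
    (hg : g =o[𝓝 0] fun z : ℂ ↦ z ^ n) : f =o[𝓝 0] fun z : ℂ ↦ z ^ (n + 1) := by
  rw [isLittleO_iff]
  intro c hc
  obtain ⟨ε, hε, h⟩ := Metric.eventually_nhds_iff_ball.mp (hf.and (isLittleO_iff.mp hg hc))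
  filter_upwards [Metric.ball_mem_nhds _ hε] with z hz
  have hz' : ‖z‖ < ε := mem_ball_zero_iff.mp hz
  have hmem {w : ℂ} (hw : w ∈ Metric.closedBall (0 : ℂ) ‖z‖) : w ∈ Metric.ball (0 : ℂ) ε :=
    mem_ball_zero_iff.mpr ((mem_closedBall_zero_iff.mp hw).trans_lt hz')
  have := (convex_closedBall (0 : ℂ) ‖z‖).norm_image_sub_le_of_norm_hasDerivWithin_le
    (f := f) (f' := g) (C := c * ‖z‖ ^ n) (x := 0) (y := z)
    (fun w hw ↦ (h w (hmem hw)).1.hasDerivWithinAt) (fun w hw ↦ ?_) (by simp) (by simp)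
  · rw [h0, sub_zero, sub_zero] at this
    rw [norm_pow, pow_succ, ← mul_assoc]
    exact this
  · refine (h w (hmem hw)).2.trans ?_
    rw [norm_pow]
    have := mem_closedBall_zero_iff.mp hw
    gcongr

lemma tendsto_div_pow_of_isLittleO {f : ℂ → ℂ} {a : ℂ} {n : ℕ}
    (h : (fun z ↦ f z - a * z ^ n) =o[𝓝 0] fun z : ℂ ↦ z ^ n) :
    Tendsto (fun z ↦ f z / z ^ n) (𝓝[≠] 0) (𝓝 a) := by
  have h1 := (h.tendsto_div_nhds_zero.mono_left (nhdsWithin_le_nhds (s := {0}ᶜ))).add_const a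
  rw [zero_add] at h1
  refine h1.congr' ?_
  filter_upwards [self_mem_nhdsWithin] with z hz
  have : z ^ n ≠ 0 := pow_ne_zero _ hz
  field_simp
  ring

namespace PeriodPair

variable (L : PeriodPair)

lemma hasDerivAt_weierstrassPExcept {z : ℂ} (hz : z ∈ ((L.lattice : Set ℂ) \ {0})ᶜ) :
    HasDerivAt ℘[L - (0 : ℂ)] (℘'[L - (0 : ℂ)] z) z := by
  rw [← L.eqOn_deriv_weierstrassPExcept_derivWeierstrassPExcept 0 hz]
  exact ((L.differentiableOn_weierstrassPExcept 0).differentiableAt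
    (L.isOpen_compl_lattice_sdiff.mem_nhds hz)).hasDerivAt

lemma derivWeierstrassPExcept_zero : ℘'[L - (0 : ℂ)] 0 = 0 := by
  simpa only [sub_self, ne_eq, OfNat.ofNat_ne_zero, not_false_eq_true, zero_pow, div_zero,
    add_zero, derivWeierstrassP_zero, ZeroMemClass.coe_zero] using L.derivWeierstrassPExcept_def 0 0

/-- Only this first-order expansion is read off from a derivative at `0`; those of `℘` and `ζ`
follow by integration. -/
lemma isLittleO_derivWeierstrassPExcept :
    (fun z ↦ ℘'[L - (0 : ℂ)] z - 6 * L.G 4 * z ^ 1) =o[𝓝 0] fun z : ℂ ↦ z ^ 1 := by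
  have h := (L.analyticAt_derivWeierstrassPExcept 0).differentiableAt.hasDerivAt
  rw [deriv_derivWeierstrassPExcept_self, sumInvPow_zero] at h
  have := hasDerivAt_iff_isLittleO.mp h
  simpa [derivWeierstrassPExcept_zero, mul_comm, mul_left_comm] using this

lemma isLittleO_weierstrassPExcept :
    (fun z ↦ ℘[L - (0 : ℂ)] z - 3 * L.G 4 * z ^ 2) =o[𝓝 0] fun z : ℂ ↦ z ^ 2 := by
  refine isLittleO_pow_succ_of_hasDerivAt ?_ (by simp) L.isLittleO_derivWeierstrassPExcept
  filter_upwards [L.compl_lattice_sdiff_singleton_mem_nhds 0] with z hz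
  refine ((L.hasDerivAt_weierstrassPExcept hz).sub ((hasDerivAt_pow 2 z).const_mul
    (3 * L.G 4))).congr_deriv ?_
  norm_num
  ring

lemma isLittleO_weierstrassZetaExcept :
    (fun z ↦ L.weierstrassZetaExcept z - -L.G 4 * z ^ 3) =o[𝓝 0] fun z : ℂ ↦ z ^ 3 := by
  refine isLittleO_pow_succ_of_hasDerivAt ?_ (by simp) L.isLittleO_weierstrassPExcept.neg_left
  filter_upwards [L.compl_lattice_sdiff_singleton_mem_nhds 0] with z hz
  refine ((L.hasDerivAt_weierstrassZetaExcept hz).sub ((hasDerivAt_pow 3 z).const_mul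
    (-L.G 4))).congr_deriv ?_
  norm_num
  ring

/-! ### The closed expression: behaviour at the origin and under translation. -/

/-- The closed expression for `-2πi` times the derivative of `℘` with respect to `ω₁`. -/
def periodExpr (z : ℂ) : ℂ :=
  2 * L.ω₂ * (℘[L] z) ^ 2 - 2 * L.η₂ * ℘[L] z
    + (L.ω₂ * L.weierstrassZeta z - L.η₂ * z) * ℘'[L] z - L.ω₂ * (L.g₂ / 3)

lemma periodExpr_eq {z : ℂ} (hz : z ≠ 0) :
    L.periodExpr z = L.ω₂ * (2 * ℘[L - (0 : ℂ)] z ^ 2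
        + L.weierstrassZetaExcept z * ℘'[L - (0 : ℂ)] z
        + (4 * (℘[L - (0 : ℂ)] z / z ^ 2) + ℘'[L - (0 : ℂ)] z / z ^ 1
          - 2 * (L.weierstrassZetaExcept z / z ^ 3)) - 20 * L.G 4)
      - L.η₂ * (2 * ℘[L - (0 : ℂ)] z + z * ℘'[L - (0 : ℂ)] z) := by
  have h1 := L.weierstrassPExcept_add 0 z
  have h2 := L.derivWeierstrassPExcept_sub 0 z
  simp only [ZeroMemClass.coe_zero, sub_zero] at h1 h2
  rw [periodExpr, ← h1, ← h2, weierstrassZeta_eq, g₂]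
  field_simp
  ring

lemma tendsto_periodExpr : Tendsto L.periodExpr (𝓝[≠] 0) (𝓝 0) := by
  have h0 : (0 : ℂ) ∈ ((L.lattice : Set ℂ) \ {0})ᶜ := by simp
  have hP : Tendsto ℘[L - (0 : ℂ)] (𝓝[≠] 0) (𝓝 0) := by
    simpa using (L.hasDerivAt_weierstrassPExcept h0).continuousAt.tendsto.mono_left
      nhdsWithin_le_nhds
  have hQ : Tendsto ℘'[L - (0 : ℂ)] (𝓝[≠] 0) (𝓝 0) := by
    simpa [derivWeierstrassPExcept_zero] using
      (L.analyticAt_derivWeierstrassPExcept 0).continuousAt.tendsto.mono_left nhdsWithin_le_nhds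
  have hE : Tendsto L.weierstrassZetaExcept (𝓝[≠] 0) (𝓝 0) := by
    simpa using (L.hasDerivAt_weierstrassZetaExcept h0).continuousAt.tendsto.mono_left
      nhdsWithin_le_nhds
  have hz : Tendsto (fun z : ℂ ↦ z) (𝓝[≠] 0) (𝓝 0) := nhdsWithin_le_nhds
  have h2 := tendsto_div_pow_of_isLittleO L.isLittleO_weierstrassPExcept
  have h1 := tendsto_div_pow_of_isLittleO L.isLittleO_derivWeierstrassPExcept
  have h3 := tendsto_div_pow_of_isLittleO L.isLittleO_weierstrassZetaExcept
  -- The limit is `ω₂(4·3 + 6 - 2·(-1) - 20)G₄ = 0`.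
  have := (((((hP.pow 2).const_mul 2).add (hE.mul hQ)).add
    (((h2.const_mul 4).add h1).sub (h3.const_mul 2))).sub_const (20 * L.G 4) |>.const_mul L.ω₂).sub
    (((hP.const_mul 2).add (hz.mul hQ)).const_mul L.η₂)
  ring_nf at this
  refine this.congr' ?_
  filter_upwards [self_mem_nhdsWithin] with z hz
  rw [L.periodExpr_eq hz]
  ring

lemma add_notMem_lattice {z l : ℂ} (hl : l ∈ L.lattice) (hz : z ∉ L.lattice) :
    z + l ∉ L.lattice := fun h ↦ hz (by simpa using sub_mem h hl)

lemma periodExpr_add_ω₂ {z : ℂ} (hz : z ∉ L.lattice) :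
    L.periodExpr (z + L.ω₂) = L.periodExpr z := by
  have h1 := L.weierstrassP_add_coe z ⟨L.ω₂, L.ω₂_mem_lattice⟩
  have h2 := L.derivWeierstrassP_add_coe z ⟨L.ω₂, L.ω₂_mem_lattice⟩
  simp only at h1 h2
  rw [periodExpr, periodExpr, h1, h2, L.weierstrassZeta_add_ω₂ hz]
  ring

lemma periodExpr_add_ω₁ (hL : 0 < (L.ω₂ / L.ω₁).im) {z : ℂ} (hz : z ∉ L.lattice) :
    L.periodExpr (z + L.ω₁) = L.periodExpr z + 2 * Real.pi * Complex.I * ℘'[L] z := by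
  have h1 := L.weierstrassP_add_coe z ⟨L.ω₁, L.ω₁_mem_lattice⟩
  have h2 := L.derivWeierstrassP_add_coe z ⟨L.ω₁, L.ω₁_mem_lattice⟩
  simp only at h1 h2
  rw [periodExpr, periodExpr, h1, h2, L.weierstrassZeta_add_ω₁ hz]
  linear_combination ℘'[L] z * L.legendre_relation hL

lemma differentiableAt_periodExpr {z : ℂ} (hz : z ∉ L.lattice) :
    DifferentiableAt ℂ L.periodExpr z := by
  have h := L.isClosed_lattice.isOpen_compl.mem_nhds hz
  have h1 := L.differentiableOn_weierstrassP.differentiableAt h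
  have h2 := L.differentiableOn_derivWeierstrassP.differentiableAt h
  have h3 := (L.hasDerivAt_weierstrassZeta hz).differentiableAt
  unfold periodExpr
  fun_prop

/-! ### The defect is entire and elliptic, hence zero. -/

open Classical in
/-- `2πi` times the difference of the two sides of the formula for `∂℘/∂ω₁`, extended by `0` to
the lattice. -/
def periodDefect (z : ℂ) : ℂ :=
  if z ∈ L.lattice then 0
  else 2 * Real.pi * Complex.I * L.weierstrassPDerivω₁ z + L.periodExpr z

lemma periodDefect_of_mem {z : ℂ} (hz : z ∈ L.lattice) : L.periodDefect z = 0 := if_pos hz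

lemma periodDefect_of_notMem {z : ℂ} (hz : z ∉ L.lattice) :
    L.periodDefect z = 2 * Real.pi * Complex.I * L.weierstrassPDerivω₁ z + L.periodExpr z :=
  if_neg hz

lemma periodDefect_add_coe (hL : 0 < (L.ω₂ / L.ω₁).im) (z : ℂ) {l : ℂ} (hl : l ∈ L.lattice) :
    L.periodDefect (z + l) = L.periodDefect z := by
  -- The periods of a function form a group, so it suffices to check the two generators.
  let G : AddSubgroup ℂ :=
    { carrier := { l | ∀ z, L.periodDefect (z + l) = L.periodDefect z }
      add_mem' := fun {a b} ha hb z ↦ by rw [← add_assoc, hb, ha]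
      zero_mem' := by simp
      neg_mem' := fun {a} ha z ↦ by rw [← ha (z + -a), neg_add_cancel_right] }
  have hsub : L.lattice ≤ G.toIntSubmodule := by
    rw [lattice, Submodule.span_le]
    rintro _ (rfl | rfl) z
    · by_cases hz : z ∈ L.lattice
      · rw [periodDefect_of_mem _ hz, periodDefect_of_mem _ (add_mem hz L.ω₁_mem_lattice)]
      · rw [periodDefect_of_notMem _ hz,
          periodDefect_of_notMem _ (L.add_notMem_lattice L.ω₁_mem_lattice hz),
          L.periodExpr_add_ω₁ hL hz]
        have := L.weierstrassPDerivω₁_add z ⟨L.ω₁, L.ω₁_mem_lattice⟩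
        simp only [coordω₁_ω₁, Complex.ofReal_one] at this
        rw [this]
        ring
    · by_cases hz : z ∈ L.lattice
      · rw [periodDefect_of_mem _ hz, periodDefect_of_mem _ (add_mem hz L.ω₂_mem_lattice)]
      · rw [periodDefect_of_notMem _ hz,
          periodDefect_of_notMem _ (L.add_notMem_lattice L.ω₂_mem_lattice hz),
          L.periodExpr_add_ω₂ hz]
        have := L.weierstrassPDerivω₁_add z ⟨L.ω₂, L.ω₂_mem_lattice⟩
        simp only [coordω₁_ω₂, Complex.ofReal_zero] at this
        rw [this]
        ring
  exact hsub hl z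

lemma differentiableAt_periodDefect_of_notMem {z : ℂ} (hz : z ∉ L.lattice) :
    DifferentiableAt ℂ L.periodDefect z := by
  have h1 := L.differentiableOn_weierstrassPDerivω₁.differentiableAt
    (L.isOpen_compl_lattice_sdiff.mem_nhds (L.mem_compl_lattice_sdiff hz _))
  have h2 := (h1.const_mul (2 * Real.pi * Complex.I)).add (L.differentiableAt_periodExpr hz)
  refine h2.congr_of_eventuallyEq ?_
  filter_upwards [L.isClosed_lattice.isOpen_compl.mem_nhds hz] with w hw
  exact L.periodDefect_of_notMem hw

/-- Removable singularity: the value `0` assigned at the origin is the limit there. -/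
lemma differentiableAt_periodDefect_zero : DifferentiableAt ℂ L.periodDefect 0 := by
  have hev : ∀ᶠ z in 𝓝[≠] (0 : ℂ), z ∉ L.lattice := by
    filter_upwards [self_mem_nhdsWithin,
      mem_nhdsWithin_of_mem_nhds (L.compl_lattice_sdiff_singleton_mem_nhds 0)] with z hz hz' hm
    exact hz' ⟨hm, hz⟩
  refine (Complex.analyticAt_of_differentiable_on_punctured_nhds_of_continuousAt
    (hev.mono fun z hz ↦ L.differentiableAt_periodDefect_of_notMem hz) ?_).differentiableAt
  rw [continuousAt_iff_punctured_nhds, L.periodDefect_of_mem (zero_mem _)]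
  have hA : Tendsto L.weierstrassPDerivω₁ (𝓝[≠] 0) (𝓝 0) := by
    simpa using ((L.differentiableOn_weierstrassPDerivω₁.differentiableAt
      (L.compl_lattice_sdiff_singleton_mem_nhds 0)).continuousAt.tendsto.mono_left
      nhdsWithin_le_nhds)
  have := (hA.const_mul (2 * Real.pi * Complex.I)).add L.tendsto_periodExpr
  rw [mul_zero, add_zero] at this
  exact this.congr' (hev.mono fun z hz ↦ (L.periodDefect_of_notMem hz).symm)

lemma differentiable_periodDefect (hL : 0 < (L.ω₂ / L.ω₁).im) :
    Differentiable ℂ L.periodDefect := by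
  intro z
  by_cases hz : z ∈ L.lattice
  · have h := L.differentiableAt_periodDefect_zero
    rw [← sub_self z] at h
    refine (DifferentiableAt.comp (f := fun w ↦ w - z) z h (by fun_prop)).congr_of_eventuallyEq
      (.of_forall fun w ↦ ?_)
    simp only [Function.comp, sub_eq_add_neg]
    exact (L.periodDefect_add_coe hL w (neg_mem hz)).symm
  · exact L.differentiableAt_periodDefect_of_notMem hz

lemma periodDefect_eq_zero (hL : 0 < (L.ω₂ / L.ω₁).im) (z : ℂ) : L.periodDefect z = 0 :=
  ((L.differentiable_periodDefect hL).apply_eq_apply_of_bounded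
    (IsZLattice.isCompact_range_of_periodic L.lattice _ (L.differentiable_periodDefect hL).continuous
      fun z _ hw ↦ L.periodDefect_add_coe hL z hw).isBounded z 0).trans
    (L.periodDefect_of_mem (zero_mem _))

/-- The derivative of `℘` with respect to the first period. -/
theorem hasDerivAt_weierstrassPFun_ω₁_eq (hL : 0 < (L.ω₂ / L.ω₁).im) {z : ℂ}
    (hz : z ∉ L.lattice) :
    HasDerivAt (fun w ↦ weierstrassPFun z w L.ω₂)
      (-(1 / (2 * (Real.pi : ℂ) * Complex.I)) * L.periodExpr z) L.ω₁ := by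
  refine (L.hasDerivAt_weierstrassPFun_ω₁ hz).congr_deriv ?_
  have h := L.periodDefect_eq_zero hL z
  rw [L.periodDefect_of_notMem hz] at h
  have hpi : 2 * (Real.pi : ℂ) * Complex.I ≠ 0 := Complex.two_pi_I_ne_zero
  field_simp
  linear_combination h

/-! ### The second period, by the orientation-preserving change of basis `(ω₂, -ω₁)`. -/

lemma linearIndependent_swap_neg {w₁ w₂ : ℂ} (h : LinearIndependent ℝ ![w₁, w₂]) :
    LinearIndependent ℝ ![w₂, -w₁] := by
  rw [LinearIndependent.pair_iff] at h ⊢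
  intro s t hst
  have := h (-t) s (by rw [← hst]; simp [add_comm])
  exact ⟨this.2, by linarith [this.1]⟩

/-- The pair of periods `(ω₂, -ω₁)`, generating the same lattice. -/
def swapNeg : PeriodPair := ⟨L.ω₂, -L.ω₁, linearIndependent_swap_neg L.indep⟩

lemma lattice_swapNeg : L.swapNeg.lattice = L.lattice := by
  ext x
  simp only [mem_lattice, swapNeg]
  constructor
  · rintro ⟨m, n, rfl⟩
    exact ⟨-n, m, by push_cast; ring⟩
  · rintro ⟨m, n, rfl⟩
    exact ⟨n, -m, by push_cast; ring⟩

lemma weierstrassP_congr {L L' : PeriodPair} (h : L.lattice = L'.lattice) : ℘[L] = ℘[L'] := by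
  ext z
  rw [weierstrassP, weierstrassP, h]

lemma derivWeierstrassP_congr {L L' : PeriodPair} (h : L.lattice = L'.lattice) :
    ℘'[L] = ℘'[L'] := by
  ext z
  rw [derivWeierstrassP, derivWeierstrassP, h]

lemma weierstrassZeta_congr {L L' : PeriodPair} (h : L.lattice = L'.lattice) :
    L.weierstrassZeta = L'.weierstrassZeta := by
  ext z
  rw [weierstrassZeta, weierstrassZeta, h]

lemma g₂_congr {L L' : PeriodPair} (h : L.lattice = L'.lattice) : L.g₂ = L'.g₂ := by
  rw [g₂, g₂, G, G, h]

lemma weierstrassPFun_swap_neg (z w₁ w₂ : ℂ) :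
    weierstrassPFun z w₂ (-w₁) = weierstrassPFun z w₁ w₂ := by
  by_cases h : LinearIndependent ℝ ![w₁, w₂]
  · have e := weierstrassPFun_eq ⟨w₁, w₂, h⟩ z
    simp only at e
    rw [e, ← weierstrassP_congr (lattice_swapNeg ⟨w₁, w₂, h⟩), ← weierstrassPFun_eq]
    rfl
  · have h' : ¬ LinearIndependent ℝ ![w₂, -w₁] := fun h' ↦ h <| by
      -- The change of basis has order four, so three more applications undo it.
      have := linearIndependent_swap_neg (linearIndependent_swap_neg
        (linearIndependent_swap_neg h'))
      simpa using this
    rw [weierstrassPFun, weierstrassPFun, dif_neg h, dif_neg h']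

lemma periodExpr_swapNeg (z : ℂ) :
    L.swapNeg.periodExpr z = -(2 * L.ω₁ * (℘[L] z) ^ 2 - 2 * L.η₁ * ℘[L] z
      + (L.ω₁ * L.weierstrassZeta z - L.η₁ * z) * ℘'[L] z - L.ω₁ * (L.g₂ / 3)) := by
  have hω : L.swapNeg.ω₂ = -L.ω₁ := rfl
  have hη : L.swapNeg.η₂ = -L.η₁ := by
    rw [η₂, η₁, hω, weierstrassZeta_congr L.lattice_swapNeg, neg_div, weierstrassZeta_neg]
    ring
  rw [periodExpr, hη, hω, weierstrassP_congr L.lattice_swapNeg,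
    derivWeierstrassP_congr L.lattice_swapNeg, weierstrassZeta_congr L.lattice_swapNeg,
    g₂_congr L.lattice_swapNeg]
  ring

lemma im_swapNeg_pos (hL : 0 < (L.ω₂ / L.ω₁).im) : 0 < (L.swapNeg.ω₂ / L.swapNeg.ω₁).im := by
  have e : L.swapNeg.ω₂ / L.swapNeg.ω₁ = -(L.ω₂ / L.ω₁)⁻¹ := by
    rw [inv_div, ← neg_div]
    rfl
  have h0 : L.ω₂ / L.ω₁ ≠ 0 := fun h ↦ by simp [h] at hL
  rw [e, Complex.neg_im, Complex.inv_im, neg_div, neg_neg]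
  exact div_pos hL (Complex.normSq_pos.mpr h0)

end PeriodPair

theorem mainTheorem7 (L : PeriodPair) (hL : 0 < (L.ω₂ / L.ω₁).im) (z : ℂ) (hz : z ∉ L.lattice) :
    HasDerivAt (fun w₁ : ℂ => PeriodPair.weierstrassPFun z w₁ L.ω₂)
      (-(1 / (2 * (Real.pi : ℂ) * Complex.I)) *
        (2 * L.ω₂ * (℘[L] z) ^ 2 - 2 * L.η₂ * ℘[L] z
          + (L.ω₂ * L.weierstrassZeta z - L.η₂ * z) * ℘'[L] z - L.ω₂ * (L.g₂ / 3)))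
      L.ω₁ ∧
    HasDerivAt (fun w₂ : ℂ => PeriodPair.weierstrassPFun z L.ω₁ w₂)
      ((1 / (2 * (Real.pi : ℂ) * Complex.I)) *
        (2 * L.ω₁ * (℘[L] z) ^ 2 - 2 * L.η₁ * ℘[L] z
          + (L.ω₁ * L.weierstrassZeta z - L.η₁ * z) * ℘'[L] z - L.ω₁ * (L.g₂ / 3)))
      L.ω₂ := by
  refine ⟨L.hasDerivAt_weierstrassPFun_ω₁_eq hL hz, ?_⟩
  have h := L.swapNeg.hasDerivAt_weierstrassPFun_ω₁_eq (L.im_swapNeg_pos hL)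
    (z := z) (by rwa [L.lattice_swapNeg])
  rw [L.periodExpr_swapNeg, neg_mul_neg] at h
  exact h.congr_of_eventuallyEq
    (.of_forall fun w ↦ (PeriodPair.weierstrassPFun_swap_neg z L.ω₁ w).symm)

end
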